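/- Let $G$ be a finite group with multiplication table $L_G=\{(x,y,xy): x,y\in G\}$; in a triple $(x,y,z)\in L_G$ call $x$ the row, $y$ the column and $z$ the entry. A \emph{transversal} of $G$ is a subset $T\subseteq L_G$ in which every element of $G$ appears exactly once as a row, exactly once as a column and exactly once as an entry. A \emph{regular row transversal} of $G$ is a subset $T\subseteq L_G$ in which every element of $G$ appears exactly once as a row, and every element of $G$ appears as a column the same number of times as it appears as an entry. The Hall--Paige theorem is the assertion that for every finite group $G$ the following are equivalent: (1) $G$ has a transversal; (2) the Sylow $2$-subgroups of $G$ are trivial or non-cyclic; (3) there is an ordering $g_1,\dots,g_n$ of all elements of $G$ (each occurring exactly once) such that $g_1\cdots g_n=1$. \textbf{Corollary.} The Hall--Paige theorem is equivalent to the claim that, for every finite group $G$, $G$ has a transversal if and only if $G$ has a regular row transversal. Moreover, the equivalence holds group by group: for each finite group $G$, conditions (1), (2), (3) are equivalent for $G$ if and only if [$G$ has a transversal if and only if $G$ has a regular row transversal]. -/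

import Mathlib

universe u

namespace LatinPlex

/-- The multiplication table of `G`: the set of triples `(x, y, x * y)`, where `x` is the row,
`y` the column and `x * y` the entry. -/
def mulTable (G : Type*) [Mul G] : Set (G × G × G) :=
  {t | t.1 * t.2.1 = t.2.2}

/-- `C` is a `k`-plex of `L`: a subset of `L` in which each symbol appears exactly `k` times as a
row, exactly `k` times as a column and exactly `k` times as an entry. -/
def IsPlex {S : Type*} (L : Set (S × S × S)) (k : ℕ) (C : Set (S × S × S)) : Prop :=
  C ⊆ L ∧ ∀ s : S,
    {t ∈ C | t.1 = s}.encard = k ∧ {t ∈ C | t.2.1 = s}.encard = k ∧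
      {t ∈ C | t.2.2 = s}.encard = k

/-- `C` is a row `k`-plex of `L`: a subset of `L` representing each row exactly `k` times. -/
def IsRowPlex {S : Type*} (L : Set (S × S × S)) (k : ℕ) (C : Set (S × S × S)) : Prop :=
  C ⊆ L ∧ ∀ s : S, {t ∈ C | t.1 = s}.encard = k

/-- `C` is (column-entry) regular: each symbol appears as a column of `C` as many times as it
appears as an entry of `C`. -/
def IsRegular {S : Type*} (C : Set (S × S × S)) : Prop :=
  ∀ s : S, {t ∈ C | t.2.1 = s}.encard = {t ∈ C | t.2.2 = s}.encard

/-- `G` has a transversal: its multiplication table has a `1`-plex. -/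
def HasTransversal (G : Type*) [Mul G] : Prop :=
  ∃ T : Set (G × G × G), IsPlex (mulTable G) 1 T

/-- `G` has a regular row transversal: its multiplication table has a regular row `1`-plex. -/
def HasRegularRowTransversal (G : Type*) [Mul G] : Prop :=
  ∃ T : Set (G × G × G), IsRowPlex (mulTable G) 1 T ∧ IsRegular T

/-- The Sylow `2`-subgroups of `G` are trivial or non-cyclic. -/
def SylowTwoTrivialOrNonCyclic (G : Type*) [Group G] : Prop :=
  ∀ P : Sylow 2 G, (P : Subgroup G) = ⊥ ∨ ¬ IsCyclic (P : Subgroup G)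

/-- There is an ordering `g₁, …, gₙ` of the elements of `G`, each occurring exactly once, such that
`g₁ ⋯ gₙ = 1`. -/
def HasFullProductOne (G : Type*) [Group G] : Prop :=
  ∃ l : List G, l.Nodup ∧ (∀ g : G, g ∈ l) ∧ l.prod = 1

/-- The assertion of the Hall–Paige theorem for the individual group `G`. -/
def HallPaigeFor (G : Type*) [Group G] : Prop :=
  List.TFAE [HasTransversal G, SylowTwoTrivialOrNonCyclic G, HasFullProductOne G]

/-- The statement of the Hall–Paige theorem: its three conditions are equivalent for every finite
group. This is only a proposition; it is nowhere assumed. -/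
def HallPaigeTheorem : Prop :=
  ∀ (G : Type u) [Group G] [Finite G], HallPaigeFor G

end LatinPlex

namespace LatinPlex

/-! For every finite group, (2) and (3) are equivalent, and (3) is equivalent to having a regular
row transversal. Hence the three conditions agree for `G` exactly when (1) agrees with the regular
row transversal condition.

A regular row transversal amounts to a map `f` and a permutation `σ` with `f (σ x) = x * f x`.
Following a cycle of `σ` once around cancels `f`, so its elements, read backwards, multiply to 1.
Conversely, the tail products of a product-one ordering define `f`.

(3) implies (2): a nontrivial cyclic Sylow 2-subgroup is the image of the transfer, whose kernel is
odd. The product of all elements then maps to an odd multiple of the element of order two.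

(2) implies (3): in odd order, pair inverses. Otherwise take an involution `u` in the centre of a
noncyclic Sylow subgroup `P`. The complement of the centralizer `C` of `u` has product one. In `C`,
let `T` be the solutions of `x * x = 1`. The pairs `x, u * x` give `T` the product `u ^ (|T| / 2)`,
and the rest of `C` cancels in inverse pairs. If 4 does not divide `|T|`, a commutator equal to `u`
in `C` absorbs the surplus `u`. If there were none, a second involution of `P` would give free Klein
four-group actions making `|T|` divisible by 4; so `u` is the only involution of `P`, and a
noncyclic 2-group with one involution has it as a commutator. -/

/-- The elements of `S` can be ordered so that their product is `p`. -/
def HasOrderedProd {G : Type*} [Group G] (S : Finset G) (p : G) : Prop :=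
  ∃ l : List G, l.Nodup ∧ (∀ g, g ∈ l ↔ g ∈ S) ∧ l.prod = p

theorem hasOrderedProd_empty {G : Type*} [Group G] : HasOrderedProd (∅ : Finset G) 1 :=
  ⟨[], by simp⟩

/-! ### Assembling ordered products from disjoint blocks. -/

section OrderedProd

variable {G : Type*} [Group G] [DecidableEq G]

theorem HasOrderedProd.union {S T : Finset G} {p q : G} (hS : HasOrderedProd S p)
    (hT : HasOrderedProd T q) (h : Disjoint S T) : HasOrderedProd (S ∪ T) (p * q) := by
  obtain ⟨l, hl, hlS, rfl⟩ := hS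
  obtain ⟨m, hm, hmT, rfl⟩ := hT
  refine ⟨l ++ m, ?_, fun g => by simp [hlS, hmT], by simp⟩
  refine hl.append hm fun g hg hg' => ?_
  exact Finset.disjoint_left.1 h ((hlS g).1 hg) ((hmT g).1 hg')

theorem HasOrderedProd.sdiff_union {S T : Finset G} {p q : G} (hT : HasOrderedProd T p)
    (hS : HasOrderedProd (S \ T) q) (h : T ⊆ S) : HasOrderedProd S (p * q) := by
  have := hT.union hS Finset.disjoint_sdiff
  rwa [Finset.union_sdiff_of_subset h] at this

theorem hasOrderedProd_toFinset {l : List G} (hl : l.Nodup) :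
    HasOrderedProd l.toFinset l.prod := ⟨l, hl, by simp, rfl⟩

/-- Blocks will be indexed by their own elements, so one block occurs under several indices; hence
equality is allowed beside disjointness. -/
theorem HasOrderedProd.biUnion {ι : Type*} [DecidableEq ι] (I : Finset ι) (B : ι → Finset G)
    (h1 : ∀ i ∈ I, HasOrderedProd (B i) 1)
    (hd : ∀ i ∈ I, ∀ j ∈ I, B i = B j ∨ Disjoint (B i) (B j)) :
    HasOrderedProd (I.biUnion B) 1 := by
  induction I using Finset.induction_on with
  | empty => simpa using hasOrderedProd_empty
  | insert i I hi ih =>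
    have ih' := ih (fun j hj => h1 j (Finset.mem_insert_of_mem hj))
      (fun j hj k hk => hd j (Finset.mem_insert_of_mem hj) k (Finset.mem_insert_of_mem hk))
    rw [Finset.biUnion_insert]
    by_cases hex : ∃ j ∈ I, B i = B j
    · obtain ⟨j, hj, hij⟩ := hex
      rw [Finset.union_eq_right.2]
      · exact ih'
      · rw [hij]; exact Finset.subset_biUnion_of_mem B hj
    · push Not at hex
      have := (h1 i (Finset.mem_insert_self _ _)).union ih' (by
        rw [Finset.disjoint_biUnion_right]
        intro j hj
        exact (hd i (Finset.mem_insert_self _ _) j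
          (Finset.mem_insert_of_mem hj)).resolve_left (hex j hj))
      simpa using this

/-- A set closed under inversion and without elements of order at most two
has an ordering with product one. -/
theorem hasOrderedProd_of_inv_mem (S : Finset G) (hinv : ∀ x ∈ S, x⁻¹ ∈ S)
    (hS : ∀ x ∈ S, x⁻¹ ≠ x) : HasOrderedProd S 1 := by
  have : S = S.biUnion fun x => {x, x⁻¹} := by
    ext g
    simp only [Finset.mem_biUnion, Finset.mem_insert, Finset.mem_singleton]
    constructor
    · exact fun h => ⟨g, h, Or.inl rfl⟩
    · rintro ⟨x, hx, rfl | rfl⟩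
      exacts [hx, hinv x hx]
  rw [this]
  refine HasOrderedProd.biUnion _ _ (fun x hx => ?_) fun x _ y _ => ?_
  · have := hasOrderedProd_toFinset (l := [x, x⁻¹]) (by simpa using (hS x hx).symm)
    simpa using this
  · by_cases h1 : x = y
    · left; rw [h1]
    by_cases h2 : x = y⁻¹
    · left; rw [h2, inv_inv, Finset.pair_comm]
    right
    rw [Finset.disjoint_left]
    intro a ha hb
    simp only [Finset.mem_insert, Finset.mem_singleton] at ha hb
    rcases ha with rfl | rfl <;> rcases hb with hb | hb
    · exact h1 hb
    · exact h2 hb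
    · exact h2 (by rw [← hb, inv_inv])
    · exact h1 (inv_injective hb)

/-- Pairing `x` with `u * x` orders a set of commuting solutions of `x * x = 1`. -/
theorem hasOrderedProd_pow_of_mul_mem {u : G} (hu1 : u ≠ 1) (hu : u * u = 1) (S : Finset G)
    (hS : ∀ x ∈ S, u * x ∈ S ∧ x * x = 1 ∧ u * x = x * u) :
    ∃ k, S.card = 2 * k ∧ HasOrderedProd S (u ^ k) := by
  induction S using Finset.strongInduction with
  | H S ih =>
    rcases S.eq_empty_or_nonempty with rfl | ⟨x, hx⟩
    · exact ⟨0, by simp, by simpa using hasOrderedProd_empty⟩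
    obtain ⟨hux, hxx, hc⟩ := hS x hx
    have hne : x ≠ u * x := by simpa using hu1
    have hsub : ({x, u * x} : Finset G) ⊆ S := by
      intro a; simp only [Finset.mem_insert, Finset.mem_singleton]
      rintro (rfl | rfl) <;> assumption
    have hss : S \ {x, u * x} ⊂ S := Finset.sdiff_ssubset hsub ⟨x, by simp⟩
    obtain ⟨k, hk, hp⟩ := ih _ hss (by
      intro y hy
      simp only [Finset.mem_sdiff, Finset.mem_insert, Finset.mem_singleton, not_or] at hy ⊢
      obtain ⟨h1, h2, h3⟩ := hS y hy.1
      refine ⟨⟨h1, ?_, ?_⟩, h2, h3⟩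
      · rintro rfl; apply hy.2.2; rw [← mul_assoc, hu, one_mul]
      · intro h; exact hy.2.1 (mul_left_cancel h))
    refine ⟨k + 1, ?_, ?_⟩
    · have := Finset.card_sdiff_add_card_eq_card hsub
      rw [Finset.card_pair hne] at this
      omega
    · have hb := hasOrderedProd_toFinset (l := [x, u * x]) (by simpa using hne)
      have hb' : HasOrderedProd ({x, u * x} : Finset G) u := by
        have e : x * (u * x) = u := by rw [hc, ← mul_assoc, hxx, one_mul]
        simpa [e] using hb
      rw [pow_succ']
      exact hb'.sdiff_union hp hsub

end OrderedProd

/-! ### Klein four-group actions and 2-groups with a unique involution. -/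

/-- Two commuting involutive maps generating a free action of a Klein four-group. -/
theorem four_dvd_card_of_involutive {α : Type*} [DecidableEq α] {a b : α → α}
    (ha : a.Involutive) (hb : b.Involutive) (hab : ∀ x, a (b x) = b (a x)) (S : Finset α)
    (hS : ∀ x ∈ S, a x ∈ S ∧ b x ∈ S ∧ a x ≠ x ∧ b x ≠ x ∧ a x ≠ b x) : 4 ∣ S.card := by
  induction S using Finset.strongInduction with
  | H S ih =>
    rcases S.eq_empty_or_nonempty with rfl | ⟨x, hx⟩
    · simp
    obtain ⟨h1, h2, h3, h4, h5⟩ := hS x hx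
    have h6 := (hS _ h2).1
    have n1 : a (b x) ≠ x := fun h => h5 (by rw [← h, ha, h])
    have n2 : a (b x) ≠ a x := fun h => h4 (ha.injective h)
    have n3 : a (b x) ≠ b x := (hS _ h2).2.2.1
    have hsub : ({x, a x, b x, a (b x)} : Finset α) ⊆ S := by
      intro y; simp only [Finset.mem_insert, Finset.mem_singleton]
      rintro (rfl | rfl | rfl | rfl) <;> assumption
    have hcard : ({x, a x, b x, a (b x)} : Finset α).card = 4 := by
      rw [Finset.card_insert_of_notMem, Finset.card_insert_of_notMem, Finset.card_pair n3.symm]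
      · simp [h5, n2.symm]
      · simp [h3.symm, h4.symm, n1.symm]
    have := Finset.card_sdiff_add_card_eq_card hsub
    rw [← this, hcard]
    refine Dvd.dvd.add (ih _ (Finset.sdiff_ssubset hsub ⟨x, by simp⟩) ?_) dvd_rfl
    intro y hy
    simp only [Finset.mem_sdiff, Finset.mem_insert, Finset.mem_singleton, not_or] at hy ⊢
    obtain ⟨hy, m1, m2, m3, m4⟩ := hy
    obtain ⟨k1, k2, k3⟩ := hS y hy
    refine ⟨⟨k1, ?_, ?_, ?_, ?_⟩, ⟨k2, ?_, ?_, ?_, ?_⟩, k3⟩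
    · intro h; exact m2 (by rw [← h, ha])
    · intro h; exact m1 (ha.injective h)
    · intro h; exact m4 (by rw [← h, ha])
    · intro h; exact m3 (ha.injective h)
    · intro h; exact m3 (by rw [← h, hb])
    · intro h; exact m4 (by rw [hab, ← h, hb])
    · intro h; exact m1 (hb.injective h)
    · intro h; rw [hab] at h; exact m2 (hb.injective h)

/-- An abelian `2`-group with at most one involution is cyclic. -/
theorem isCyclic_of_unique_involution {P : Type*} [CommGroup P] [Finite P]
    (hP : IsPGroup 2 P) {u : P} (hu : ∀ x : P, x * x = 1 → x = 1 ∨ x = u) : IsCyclic P := by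
  classical
  have := Fintype.ofFinite P
  -- Squaring maps solutions at level `k + 1` to solutions at level `k`, with fibres of size at most
  -- two.
  have key : ∀ k : ℕ, (Finset.univ.filter fun x : P => x ^ 2 ^ k = 1).card ≤ 2 ^ k := by
    intro k
    induction k with
    | zero => exact Finset.card_le_one.2 (by simp +contextual)
    | succ k ih =>
      rw [pow_succ' 2 k]
      refine (Finset.card_le_mul_card_image_of_maps_to (f := fun x => x * x)
        (t := Finset.univ.filter fun x : P => x ^ 2 ^ k = 1) ?_ 2 ?_).trans
        (Nat.mul_le_mul_left 2 ih)
      · intro x hx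
        simp only [Finset.mem_filter, Finset.mem_univ, true_and] at hx ⊢
        rw [← pow_two, ← pow_mul, hx]
      · intro b _
        rcases Finset.eq_empty_or_nonempty
          ((Finset.univ.filter fun x : P => x ^ (2 * 2 ^ k) = 1).filter fun x => x * x = b)
          with h | ⟨y, hy⟩
        · rw [h]; simp
        · refine (Finset.card_le_card (t := {y, u * y}) ?_).trans Finset.card_le_two
          intro x hx
          simp only [Finset.mem_filter, Finset.mem_univ, true_and, Finset.mem_insert,
            Finset.mem_singleton] at hx hy ⊢
          rcases hu (x * y⁻¹) (by
            rw [mul_mul_mul_comm, hx.2, ← mul_inv, hy.2, mul_inv_cancel]) with h | h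
          · left; exact mul_inv_eq_one.1 h
          · right; exact mul_inv_eq_iff_eq_mul.1 h
  obtain ⟨r, hr⟩ := IsPGroup.iff_card.1 hP
  refine isCyclic_of_card_pow_eq_one_le fun n hn => ?_
  obtain ⟨v, -, hv⟩ := (Nat.dvd_prime_pow Nat.prime_two).1 (Nat.gcd_dvd_right n (2 ^ r))
  refine (Finset.card_le_card ?_).trans ((key v).trans (hv ▸ Nat.gcd_le_left _ hn))
  intro x hx
  simp only [Finset.mem_filter, Finset.mem_univ, true_and] at hx ⊢
  rw [← hv]
  exact pow_gcd_eq_one.2 ⟨hx, hr ▸ pow_card_eq_one'⟩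

/-- A noncyclic `2`-group with a unique involution has it as a commutator. -/
theorem exists_commutator_eq_of_unique_involution {P : Type*} [Group P] [Finite P]
    (hP : IsPGroup 2 P) (hcyc : ¬ IsCyclic P) {u : P}
    (hu : ∀ x : P, x * x = 1 → x = 1 ∨ x = u) : ∃ x y : P, x * y = u * (y * x) := by
  -- If `c` has order `2 ^ (k + 1)`, then `c ^ 2 ^ k` is an involution, hence `u`.
  have hpow : ∀ c : P, c ≠ 1 → ∃ j : ℕ, c ^ j = u := by
    intro c hc
    obtain ⟨k, hk⟩ := (IsPGroup.iff_orderOf.1 hP) c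
    cases k with
    | zero => simp at hk; exact absurd hk hc
    | succ k =>
      refine ⟨2 ^ k, (hu _ ?_).resolve_left ?_⟩
      · rw [← pow_add, ← two_mul, ← pow_succ', ← hk, pow_orderOf_eq_one]
      · intro h
        have := orderOf_dvd_of_pow_eq_one h
        rw [hk] at this
        have := Nat.le_of_dvd (by positivity) this
        rw [pow_succ] at this
        have : 0 < 2 ^ k := by positivity
        omega
  by_cases hab : ∀ x y : P, x * y = y * x
  · exfalso
    apply hcyc
    let _ : CommGroup P := { ‹Group P› with mul_comm := hab }
    exact isCyclic_of_unique_involution hP hu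
  · push Not at hab
    obtain ⟨x, y, hxy⟩ := hab
    have hnt : Nontrivial (P ⧸ Subgroup.center P) := by
      rw [QuotientGroup.nontrivial_iff]
      intro h
      have : x ∈ Subgroup.center P := h ▸ Subgroup.mem_top x
      exact hxy (Subgroup.mem_center_iff.1 this y).symm
    have := (hP.to_quotient (Subgroup.center P)).center_nontrivial
    -- Take `m` noncentral but central modulo the centre: its commutators are central, so the
    -- commutator of `m ^ j` with `b` is `c ^ j`.
    obtain ⟨⟨q, hq⟩, hq1⟩ := exists_ne (1 : Subgroup.center (P ⧸ Subgroup.center P))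
    obtain ⟨m, rfl⟩ := QuotientGroup.mk_surjective q
    have hm : m ∉ Subgroup.center P := by
      intro h; apply hq1; ext; exact (QuotientGroup.eq_one_iff m).2 h
    rw [Subgroup.mem_center_iff] at hm
    push Not at hm
    obtain ⟨b, hb⟩ := hm
    have hc : m * b * (b * m)⁻¹ ∈ Subgroup.center P := by
      rw [← QuotientGroup.eq_one_iff]
      have := Subgroup.mem_center_iff.1 hq (b : P ⧸ Subgroup.center P)
      rw [QuotientGroup.mk_mul, QuotientGroup.mk_inv, QuotientGroup.mk_mul, QuotientGroup.mk_mul,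
        this, mul_inv_cancel]
    set c := m * b * (b * m)⁻¹ with hcdef
    have hmb : m * b = c * (b * m) := by rw [hcdef, inv_mul_cancel_right]
    have hc1 : c ≠ 1 := fun h => hb (by rw [hmb, h, one_mul])
    obtain ⟨j, hj⟩ := hpow c hc1
    refine ⟨m ^ j, b, ?_⟩
    rw [← hj]
    clear hj
    induction j with
    | zero => simp
    | succ j ih =>
      have hcm := Subgroup.mem_center_iff.1 hc (m ^ j)
      calc m ^ (j + 1) * b = m ^ j * (m * b) := by rw [pow_succ, mul_assoc]
        _ = c * (m ^ j * b) * m := by rw [hmb, ← mul_assoc, hcm]; group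
        _ = c ^ (j + 1) * (b * m ^ (j + 1)) := by rw [ih, pow_succ', pow_succ]; group


/-! ### Regular row transversals and product-one orderings. -/

theorem hasFullProductOne_iff {G : Type*} [Group G] [Fintype G] :
    HasFullProductOne G ↔ HasOrderedProd (Finset.univ : Finset G) 1 := by
  simp [HasFullProductOne, HasOrderedProd]

/-- A row transversal is given by the function sending a row to its column; it is regular exactly
when a permutation carries each entry to an equal column. -/
theorem hasRegularRowTransversal_iff {G : Type*} [Group G] [Finite G] :
    HasRegularRowTransversal G ↔
      ∃ (f : G → G) (σ : Equiv.Perm G), ∀ x, f (σ x) = x * f x := by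
  have hcol : ∀ (f : G → G) (s : G), {t ∈ {t : G × G × G | t.2.1 = f t.1 ∧ t.1 * t.2.1 = t.2.2} |
      t.2.1 = s} = (fun x => (x, f x, x * f x)) '' {x | f x = s} := by
    intro f s
    ext ⟨a, b, c⟩
    simp only [Set.mem_ofPred_eq, Set.mem_image, Prod.mk.injEq]
    constructor
    · rintro ⟨⟨rfl, rfl⟩, rfl⟩; exact ⟨a, rfl, rfl, rfl, rfl⟩
    · rintro ⟨x, rfl, rfl, rfl, rfl⟩; exact ⟨⟨rfl, rfl⟩, rfl⟩
  have hent : ∀ (f : G → G) (s : G), {t ∈ {t : G × G × G | t.2.1 = f t.1 ∧ t.1 * t.2.1 = t.2.2} |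
      t.2.2 = s} = (fun x => (x, f x, x * f x)) '' {x | x * f x = s} := by
    intro f s
    ext ⟨a, b, c⟩
    simp only [Set.mem_ofPred_eq, Set.mem_image, Prod.mk.injEq]
    constructor
    · rintro ⟨⟨rfl, rfl⟩, rfl⟩; exact ⟨a, rfl, rfl, rfl, rfl⟩
    · rintro ⟨x, rfl, rfl, rfl, rfl⟩; exact ⟨⟨rfl, rfl⟩, rfl⟩
  have hinj : ∀ f : G → G, Function.Injective fun x => (x, f x, x * f x) :=
    fun f x y h => (Prod.mk.inj h).1
  constructor
  · rintro ⟨T, ⟨hTL, hT⟩, hreg⟩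
    have hrow : ∀ s, ∃ t ∈ T, t.1 = s ∧ ∀ t' ∈ T, t'.1 = s → t' = t := by
      intro s
      obtain ⟨t, ht⟩ := Set.encard_eq_one.1 (by simpa using hT s)
      have h1 : t ∈ {t ∈ T | t.1 = s} := by rw [ht]; rfl
      refine ⟨t, h1.1, h1.2, fun t' ht' hs => ?_⟩
      have h2 : t' ∈ {t ∈ T | t.1 = s} := ⟨ht', hs⟩
      rwa [ht] at h2
    choose F hFT hF1 hFu using hrow
    let f : G → G := fun s => (F s).2.1
    have hTf : T = {t : G × G × G | t.2.1 = f t.1 ∧ t.1 * t.2.1 = t.2.2} := by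
      ext t
      constructor
      · intro ht
        refine ⟨?_, hTL ht⟩
        rw [hFu t.1 t ht rfl]
        simp only [f, hF1]
      · rintro ⟨h1, h2⟩
        have : t = F t.1 := by
          have h3 : (F t.1).1 * (F t.1).2.1 = (F t.1).2.2 := hTL (hFT t.1)
          refine Prod.ext (hF1 _).symm (Prod.ext h1 ?_)
          rw [← h2, ← h3, hF1, h1]
        rw [this]
        exact hFT _
    have hcard : ∀ s, Nonempty ({x // x * f x = s} ≃ {x // f x = s}) := by
      intro s
      have h := hreg s
      rw [hTf, hcol, hent, (hinj f).encard_image, (hinj f).encard_image] at h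
      refine Nonempty.intro (Finite.equivFinOfCardEq (n := Nat.card {x // f x = s}) ?_ |>.trans
        (Finite.equivFin _).symm)
      change Nat.card ({x | x * f x = s} : Set G) = Nat.card ({x | f x = s} : Set G)
      rw [Nat.card_coe_set_eq, Nat.card_coe_set_eq, Set.ncard, Set.ncard, h]
    -- Bijections between the fibres of `x ↦ x * f x` and of `f` over each `s` glue to a
    -- permutation.
    refine ⟨f, ((Equiv.sigmaFiberEquiv fun x => x * f x).symm.trans
      (Equiv.sigmaCongrRight fun s => (hcard s).some)).trans (Equiv.sigmaFiberEquiv f), fun x => ?_⟩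
    exact ((hcard (x * f x)).some ⟨x, rfl⟩).2
  · rintro ⟨f, σ, h⟩
    refine ⟨{t : G × G × G | t.2.1 = f t.1 ∧ t.1 * t.2.1 = t.2.2}, ⟨fun t ht => ht.2, fun s => ?_⟩,
      fun s => ?_⟩
    · rw [Nat.cast_one, Set.encard_eq_one]
      refine ⟨(s, f s, s * f s), ?_⟩
      ext ⟨a, b, c⟩
      simp only [Set.mem_ofPred_eq, Set.mem_singleton_iff, Prod.mk.injEq]
      constructor
      · rintro ⟨⟨rfl, rfl⟩, rfl⟩; exact ⟨rfl, rfl, rfl⟩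
      · rintro ⟨rfl, rfl, rfl⟩; exact ⟨⟨rfl, rfl⟩, rfl⟩
    · rw [hcol, hent, (hinj f).encard_image, (hinj f).encard_image]
      have : {x | f x = s} = σ '' {x | x * f x = s} := by
        rw [Equiv.image_eq_preimage_symm]
        ext x
        simp [← h]
      rw [this, σ.injective.encard_image]

open Function in
theorem hasFullProductOne_of_perm {G : Type*} [Group G] [Finite G] {f : G → G}
    {σ : Equiv.Perm G} (h : ∀ x, f (σ x) = x * f x) : HasFullProductOne G := by
  classical
  have := Fintype.ofFinite G
  rw [hasFullProductOne_iff]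
  let B : G → Finset G := fun x => Finset.univ.filter fun y => σ.SameCycle x y
  have huniv : (Finset.univ : Finset G) = Finset.univ.biUnion B := by
    ext x
    simp only [Finset.mem_univ, Finset.mem_biUnion, true_and, true_iff]
    exact ⟨x, by simp [B, Equiv.Perm.SameCycle.refl]⟩
  rw [huniv]
  refine HasOrderedProd.biUnion _ _ (fun x _ => ?_) fun x _ y _ => ?_
  · have hprod : ∀ n, (((List.range n).map fun i => σ^[i] x).reverse).prod * f x
        = f (σ^[n] x) := by
      intro n
      induction n with
      | zero => simp
      | succ n ih =>
        rw [List.range_succ, List.map_append, List.reverse_append, List.prod_append, mul_assoc, ih,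
          iterate_succ_apply', h]
        simp
    refine ⟨((List.range (minimalPeriod σ x)).map fun i => σ^[i] x).reverse, ?_, fun y => ?_, ?_⟩
    · rw [List.nodup_reverse]
      refine List.Nodup.map_on ?_ List.nodup_range
      intro i hi j hj hij
      exact iterate_injOn_Iio_minimalPeriod (List.mem_range.1 hi) (List.mem_range.1 hj) hij
    · simp only [List.mem_reverse, List.mem_map, List.mem_range, B, Finset.mem_filter,
        Finset.mem_univ, true_and]
      constructor
      · rintro ⟨i, -, rfl⟩
        rw [← Equiv.Perm.coe_pow]
        exact Equiv.Perm.sameCycle_pow_right.2 (Equiv.Perm.SameCycle.refl _ _)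
      · intro hxy
        obtain ⟨i, -, hi⟩ := hxy.exists_pow_eq'
        refine ⟨i % minimalPeriod σ x, Nat.mod_lt _ ?_, ?_⟩
        · exact minimalPeriod_pos_of_mem_periodicPts
            (σ.injective.mem_periodicPts x)
        · rw [iterate_mod_minimalPeriod_eq, ← Equiv.Perm.coe_pow, hi]
    · have := hprod (minimalPeriod σ x)
      rw [iterate_minimalPeriod] at this
      exact mul_eq_right.1 this
  · by_cases hxy : σ.SameCycle x y
    · left
      ext z
      simp only [B, Finset.mem_filter, Finset.mem_univ, true_and]
      exact ⟨fun hz => hxy.symm.trans hz, fun hz => hxy.trans hz⟩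
    · right
      rw [Finset.disjoint_left]
      intro z hz hz'
      simp only [B, Finset.mem_filter, Finset.mem_univ, true_and] at hz hz'
      exact hxy (hz.trans hz'.symm)

/-- Let `f x` be the product of the terms after `x` and `σ` the cyclic predecessor. Then `x * f x`
is the product of the terms after `σ x`; at the wrap-around this needs the full product to equal the
empty one. -/
theorem HasFullProductOne.exists_perm {G : Type*} [Group G] (hG : HasFullProductOne G) :
    ∃ (f : G → G) (σ : Equiv.Perm G), ∀ x, f (σ x) = x * f x := by
  classical
  obtain ⟨l, hl, hmem, hprod⟩ := hG
  obtain ⟨m, hm⟩ : ∃ m, l.length = m + 1 :=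
    Nat.exists_eq_succ_of_ne_zero (by
      intro h; rw [List.length_eq_zero_iff] at h; simpa [h] using hmem 1)
  let e : Fin (m + 1) ≃ G := (finCongr hm.symm).trans (hl.getEquivOfForallMemList l hmem)
  let ρ := finRotate (m + 1)
  have he : ∀ i, e i = l[(i : ℕ)]'(by omega) := fun i => rfl
  refine ⟨fun x => (l.drop ((e.symm x : ℕ) + 1)).prod, (e.symm.trans ρ.symm).trans e, fun x => ?_⟩
  obtain ⟨i, rfl⟩ := e.surjective x
  obtain ⟨j, rfl⟩ := ρ.surjective i
  simp only [Equiv.trans_apply, Equiv.symm_apply_apply]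
  rw [he, ← List.prod_cons, ← List.drop_eq_getElem_cons]
  by_cases hj : j = Fin.last m
  · subst hj
    have : ρ (Fin.last m) = 0 := by simp [ρ]
    simp [this, hprod, ← hm]
  · congr 2
    simp only [ρ]
    rw [coe_finRotate_of_ne_last hj]

theorem hasRegularRowTransversal_iff_hasFullProductOne {G : Type*} [Group G] [Finite G] :
    HasRegularRowTransversal G ↔ HasFullProductOne G := by
  rw [hasRegularRowTransversal_iff]
  exact ⟨fun ⟨_, _, h⟩ => hasFullProductOne_of_perm h, HasFullProductOne.exists_perm⟩

theorem HasTransversal.hasRegularRowTransversal {G : Type*} [Mul G] (h : HasTransversal G) :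
    HasRegularRowTransversal G := by
  obtain ⟨T, hT, h⟩ := h
  exact ⟨T, ⟨hT, fun s => (h s).1⟩, fun s => (h s).2.1.trans (h s).2.2.symm⟩


/-! ### Nontrivial cyclic Sylow 2-subgroups obstruct product one. -/

theorem sum_zmod_two_mul (m : ℕ) (hm : m ≠ 0) [NeZero (2 * m)] :
    ∑ z : ZMod (2 * m), z = (m : ZMod (2 * m)) := by
  have h1 : ∑ z : ZMod (2 * m), z = ((∑ i ∈ Finset.range (2 * m), i : ℕ) : ZMod (2 * m)) := by
    rw [Nat.cast_sum]
    refine Finset.sum_nbij' (fun z => z.val) (fun i => (i : ZMod (2 * m))) ?_ ?_ ?_ ?_ ?_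
    · intro z _; simpa using ZMod.val_lt z
    · simp
    · intro z _; simp
    · intro i hi; exact ZMod.val_cast_of_lt (Finset.mem_range.1 hi)
    · intro z _; simp
  have h2 : ∑ i ∈ Finset.range (2 * m), i = m + 2 * m * (m - 1) := by
    have := Finset.sum_range_id_mul_two (2 * m)
    obtain ⟨k, rfl⟩ := Nat.exists_eq_succ_of_ne_zero hm
    have e : 2 * (k + 1) - 1 = 2 * k + 1 := by omega
    simp only [Nat.succ_eq_add_one, e, Nat.add_sub_cancel] at this ⊢
    nlinarith
  rw [h1, h2, Nat.cast_add, Nat.cast_mul, ZMod.natCast_self, zero_mul, add_zero]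

/-- A group with a homomorphism of odd kernel onto a cyclic group of even order does not have
an ordering with product one. -/
theorem not_hasFullProductOne_of_surjective {G : Type*} [Group G] [Finite G] {m : ℕ} (hm : m ≠ 0)
    (φ : G →* Multiplicative (ZMod (2 * m))) (hφ : Function.Surjective φ)
    (hker : ¬ 2 ∣ Nat.card φ.ker) : ¬ HasFullProductOne G := by
  classical
  rintro ⟨l, hl, hmem, hprod⟩
  have := Fintype.ofFinite G
  have : NeZero (2 * m) := ⟨by omega⟩
  have hl' : l.toFinset = Finset.univ := by ext; simp [hmem]
  have h0 : ∑ g : G, (φ g).toAdd = 0 := by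
    have h1 : ∏ g : G, φ g = 1 := by
      rw [← hl', List.prod_toFinset _ hl, ← map_list_prod, hprod, map_one]
    exact congrArg Multiplicative.toAdd h1
  have hfib : ∀ z : ZMod (2 * m),
      (Finset.univ.filter fun g => (φ g).toAdd = z).card = Nat.card φ.ker := by
    intro z
    have := MonoidHom.card_fiber_eq_of_mem_range φ (x := Multiplicative.ofAdd z) (y := 1) (hφ _) (hφ _)
    refine Eq.trans this ?_
    rw [Nat.card_eq_fintype_card, Fintype.card_subtype]
    simp only [MonoidHom.mem_ker]
  rw [← Finset.sum_fiberwise Finset.univ (fun g => (φ g).toAdd)] at h0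
  have h2 : ∀ z : ZMod (2 * m), ∑ g with (φ g).toAdd = z, (φ g).toAdd = Nat.card φ.ker • z := by
    intro z
    rw [Finset.sum_congr rfl (g := fun _ => z) (fun g hg => (Finset.mem_filter.1 hg).2),
      Finset.sum_const, hfib]
  simp only [h2] at h0
  -- The total is `|ker φ| * m` modulo `2 * m`, which vanishes only for an even kernel.
  rw [← Finset.smul_sum, sum_zmod_two_mul m hm, nsmul_eq_mul, ← Nat.cast_mul,
    ZMod.natCast_eq_zero_iff] at h0
  exact hker (Nat.dvd_of_mul_dvd_mul_right (Nat.pos_of_ne_zero hm) h0)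

/-- As 2 is the least prime factor of `|G|`, a cyclic `P` has a normal complement, the kernel of the
transfer to `P`. -/
theorem HasFullProductOne.sylowTwoTrivialOrNonCyclic {G : Type*} [Group G] [Finite G]
    (h : HasFullProductOne G) : SylowTwoTrivialOrNonCyclic G := by
  intro P
  by_contra hP
  push Not at hP
  obtain ⟨hbot, hcyc⟩ := hP
  have hcard : Nat.card P ≠ 1 := fun h => hbot (Subgroup.card_eq_one.1 h)
  have h2P : 2 ∣ Nat.card P := P.2.card_eq_or_dvd.resolve_left hcard
  have hmin : (Nat.card G).minFac = 2 :=
    (Nat.minFac_eq_two_iff _).2 (h2P.trans (Subgroup.card_subgroup_dvd_card _))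
  obtain ⟨m, hm⟩ := h2P
  have hm0 : m ≠ 0 := by rintro rfl; exact Nat.card_pos.ne' hm
  let τ := MonoidHom.transferSylow P (IsCyclic.normalizer_le_centralizer hmin hcyc)
  have hcompl : τ.ker.IsComplement' P := IsCyclic.isComplement' hmin hcyc
  have hsurj : Function.Surjective τ := by
    rw [← MonoidHom.range_eq_top, ← Subgroup.card_eq_iff_eq_top]
    have h1 := hcompl.card_mul_card
    have h2 := τ.ker.card_mul_index
    rw [Subgroup.index_ker] at h2
    exact Nat.eq_of_mul_eq_mul_left Nat.card_pos (h2.trans h1.symm)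
  have : NeZero (2 * m) := ⟨by omega⟩
  let e : P ≃* Multiplicative (ZMod (2 * m)) :=
    mulEquivOfCyclicCardEq (by rw [hm]; simp)
  refine not_hasFullProductOne_of_surjective hm0 (e.toMonoidHom.comp τ)
    (e.surjective.comp hsurj) ?_ h
  have hk : (e.toMonoidHom.comp τ).ker = τ.ker := by
    ext x; simp [MonoidHom.mem_ker]
  rw [hk]
  exact MonoidHom.not_dvd_card_ker_transferSylow P _


/-! ### Orderings outside and inside the centralizer of an involution. -/

section Involution

variable {G : Type*} [Group G] [Fintype G] [DecidableEq G]

/-- Outside the centralizer of an involution `u`, the double cosets of `{1, u}` that contain an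
involution, together with inverse pairs, give an ordering with product one. -/
theorem hasOrderedProd_compl_centralizer {u : G} (hu : u * u = 1) :
    HasOrderedProd (Finset.univ.filter fun x : G => u * x ≠ x * u) 1 := by
  have hu' : ∀ x : G, u * (u * x) = x := fun x => by rw [← mul_assoc, hu, one_mul]
  let B : G → Finset G := fun s => {s, s * u, u * (s * u), u * s}
  have hB : ∀ s z, z ∈ B s ↔ z = s ∨ z = s * u ∨ z = u * (s * u) ∨ z = u * s := by simp [B]
  have hsymm : ∀ s z, z ∈ B s → s ∈ B z := by
    intro s z h
    rw [hB] at h ⊢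
    rcases h with rfl | rfl | rfl | rfl <;> simp [mul_assoc, hu, hu']
  have htrans : ∀ s z, z ∈ B s → B z ⊆ B s := by
    intro s z h w hw
    rw [hB] at h hw ⊢
    rcases h with rfl | rfl | rfl | rfl <;> rcases hw with rfl | rfl | rfl | rfl <;>
      simp [mul_assoc, hu, hu']
  have hne : ∀ x : G, u * x ≠ x * u → u * (x * u) ≠ x := by
    intro x h h'
    apply h
    calc u * x = u * (u * (x * u)) := by rw [h']
      _ = x * u := hu' _
  have hE : HasOrderedProd ((Finset.univ.filter fun s : G => u * s ≠ s * u ∧ s * s = 1).biUnion B)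
      1 := by
    refine HasOrderedProd.biUnion _ _ (fun s hs => ?_) fun s _ t _ => ?_
    · obtain ⟨-, hs, hss⟩ := Finset.mem_filter.1 hs
      have hu1 : u ≠ 1 := by rintro rfl; simp at hs
      have h1 := hne s hs
      -- In this order every `u` meets another `u`, leaving `s ^ 4 = 1`.
      have := hasOrderedProd_toFinset (l := [s, s * u, u * (s * u), u * s]) (by
        simp only [List.nodup_cons, List.mem_cons, List.not_mem_nil, or_false, not_or,
          not_false_eq_true, List.nodup_nil, and_true]
        refine ⟨⟨by simpa using hu1, h1.symm, by simpa using hu1⟩, ⟨by simpa using hu1, hs.symm⟩,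
          by simpa using hu1⟩)
      have hp : [s, s * u, u * (s * u), u * s].prod = 1 := by
        simp [mul_assoc, hu', hss, hu]
      rw [hp] at this
      simpa [B] using this
    · by_cases h : t ∈ B s
      · left
        exact (htrans t s (hsymm s t h)).antisymm (htrans s t h)
      · right
        rw [Finset.disjoint_left]
        intro z hz hz'
        exact h (htrans s z hz (hsymm t z hz'))
  have hEsub : (Finset.univ.filter fun s : G => u * s ≠ s * u ∧ s * s = 1).biUnion B ⊆
      Finset.univ.filter fun x : G => u * x ≠ x * u := by
    intro z hz
    obtain ⟨s, hs, hz⟩ := Finset.mem_biUnion.1 hz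
    obtain ⟨-, hs, -⟩ := Finset.mem_filter.1 hs
    rw [hB] at hz
    refine Finset.mem_filter.2 ⟨Finset.mem_univ _, ?_⟩
    have h1 := hne s hs
    rcases hz with rfl | rfl | rfl | rfl
    · exact hs
    · simpa [mul_assoc, hu] using h1
    · simpa [mul_assoc, hu, hu'] using hs.symm
    · simpa [mul_assoc, hu'] using h1.symm
  have := hE.sdiff_union (q := 1) ?_ hEsub
  · simpa using this
  -- Up to conjugation by `u`, a double coset contains only `x` and `x * u`, so these decide whether
  -- it has an involution. The condition is stable under inversion.
  have hmem : ∀ x : G, x ∈ (Finset.univ.filter fun x : G => u * x ≠ x * u) \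
      ((Finset.univ.filter fun s : G => u * s ≠ s * u ∧ s * s = 1).biUnion B) ↔
      u * x ≠ x * u ∧ x * x ≠ 1 ∧ (x * u) * (x * u) ≠ 1 := by
    intro x
    rw [Finset.mem_sdiff, Finset.mem_filter]
    constructor
    · rintro ⟨⟨-, hx⟩, hn⟩
      refine ⟨hx, fun h => hn ?_, fun h => hn ?_⟩
      · exact Finset.mem_biUnion.2 ⟨x, by simp [hx, h], by simp [B]⟩
      · refine Finset.mem_biUnion.2 ⟨x * u, ?_, by simp [B, mul_assoc, hu]⟩
        refine Finset.mem_filter.2 ⟨Finset.mem_univ _, ?_, h⟩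
        simpa [mul_assoc, hu] using hne x hx
    · rintro ⟨hx, h1, h2⟩
      refine ⟨⟨Finset.mem_univ _, hx⟩, fun h => ?_⟩
      obtain ⟨s, hs, hz⟩ := Finset.mem_biUnion.1 h
      obtain ⟨-, hs, hss⟩ := Finset.mem_filter.1 hs
      have hss' : ∀ x : G, s * (s * x) = x := fun x => by rw [← mul_assoc, hss, one_mul]
      rw [hB] at hz
      rcases hz with rfl | rfl | rfl | rfl
      · exact h1 hss
      · exact h2 (by simp [mul_assoc, hu, hss])
      · exact h1 (by simp [mul_assoc, hu, hu', hss'])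
      · exact h2 (by simp [mul_assoc, hu, hu', hss'])
  refine hasOrderedProd_of_inv_mem _ (fun x hx => ?_) fun x hx h => ?_
  · rw [hmem] at hx ⊢
    obtain ⟨h1, h2, h3⟩ := hx
    refine ⟨fun h => h1 ?_, fun h => h2 ?_, fun h => h3 ?_⟩
    · have : Commute u x⁻¹ := h
      exact (Commute.inv_right_iff.1 this).eq
    · rw [← mul_inv_rev] at h; exact inv_eq_one.1 h
    · have hui : u⁻¹ = u := inv_eq_of_mul_eq_one_left hu
      have h4 : (u * x) * (u * x) = 1 := by
        rw [← inv_eq_one, mul_inv_rev, mul_inv_rev, hui]; exact h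
      calc x * u * (x * u) = u * ((u * x) * (u * x)) * u := by simp [mul_assoc, hu']
        _ = 1 := by rw [h4, mul_one, hu]
  · rw [hmem] at hx
    exact hx.2.1 (by nth_rw 1 [← h]; exact inv_mul_cancel x)

theorem inv_mem_centralizer_sdiff {u x : G}
    (hx : x ∈ Finset.univ.filter fun x : G => u * x = x * u ∧ x * x ≠ 1) :
    x⁻¹ ∈ (Finset.univ.filter fun x : G => u * x = x * u ∧ x * x ≠ 1) ∧ x⁻¹ ≠ x := by
  obtain ⟨-, h1, h2⟩ := Finset.mem_filter.1 hx
  refine ⟨Finset.mem_filter.2 ⟨Finset.mem_univ _, ?_, fun h => h2 ?_⟩, fun h => h2 ?_⟩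
  · have : Commute u x := h1
    exact this.inv_right.eq
  · rw [← mul_inv_rev] at h; exact inv_eq_one.1 h
  · nth_rw 1 [← h]; exact inv_mul_cancel x

theorem filter_centralizer_eq_union (u : G) :
    (Finset.univ.filter fun x : G => u * x = x * u) =
      (Finset.univ.filter fun x : G => u * x = x * u ∧ x * x = 1) ∪
        Finset.univ.filter fun x : G => u * x = x * u ∧ x * x ≠ 1 := by
  ext x
  simp only [Finset.mem_filter, Finset.mem_univ, true_and, Finset.mem_union]
  tauto

theorem disjoint_filter_centralizer (u : G) :
    Disjoint (Finset.univ.filter fun x : G => u * x = x * u ∧ x * x = 1)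
      (Finset.univ.filter fun x : G => u * x = x * u ∧ x * x ≠ 1) := by
  rw [Finset.disjoint_filter]
  tauto

theorem mul_mem_involutions {u : G} (hu : u * u = 1) {x : G}
    (hx : x ∈ Finset.univ.filter fun x : G => u * x = x * u ∧ x * x = 1) :
    u * x ∈ (Finset.univ.filter fun x : G => u * x = x * u ∧ x * x = 1) ∧ x * x = 1 ∧
      u * x = x * u := by
  obtain ⟨-, h1, h2⟩ := Finset.mem_filter.1 hx
  refine ⟨Finset.mem_filter.2 ⟨Finset.mem_univ _, ?_, ?_⟩, h2, h1⟩
  · rw [h1, ← mul_assoc, h1]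
  · nth_rw 2 [h1]; rw [mul_assoc, ← mul_assoc x, h2, one_mul, hu]

theorem hasOrderedProd_centralizer_of_four_dvd {u : G} (hu1 : u ≠ 1) (hu : u * u = 1)
    (h4 : 4 ∣ (Finset.univ.filter fun x : G => u * x = x * u ∧ x * x = 1).card) :
    HasOrderedProd (Finset.univ.filter fun x : G => u * x = x * u) 1 := by
  obtain ⟨k, hk, hp⟩ := hasOrderedProd_pow_of_mul_mem hu1 hu _ fun x hx => mul_mem_involutions hu hx
  obtain ⟨j, rfl⟩ : 2 ∣ k := by omega
  rw [pow_mul, pow_two, hu, one_pow] at hp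
  rw [filter_centralizer_eq_union]
  have := hp.union (hasOrderedProd_of_inv_mem _ (fun x hx => (inv_mem_centralizer_sdiff hx).1)
    fun x hx => (inv_mem_centralizer_sdiff hx).2) (disjoint_filter_centralizer u)
  simpa using this

/-- If the number of solutions of `x * x = 1` in the centralizer of `u` is not divisible by four,
a commutator in the centralizer equal to `u` corrects the product. -/
theorem hasOrderedProd_centralizer_of_commutator {u : G} (hu1 : u ≠ 1) (hu : u * u = 1)
    (h4 : ¬ 4 ∣ (Finset.univ.filter fun x : G => u * x = x * u ∧ x * x = 1).card)
    {x y : G} (hx : u * x = x * u) (hy : u * y = y * u) (hxy : x * y = u * (y * x)) :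
    HasOrderedProd (Finset.univ.filter fun x : G => u * x = x * u) 1 := by
  have hu' : ∀ x : G, u * (u * x) = x := fun x => by rw [← mul_assoc, hu, one_mul]
  have hne : x * y ≠ y * x := by
    intro h; rw [h] at hxy; exact hu1 (by simpa using hxy.symm)
  obtain ⟨k, hk, hp⟩ := hasOrderedProd_pow_of_mul_mem hu1 hu _ fun x hx => mul_mem_involutions hu hx
  -- the case where exactly one of the two elements is an involution
  have mixed : ∀ x y : G, u * x = x * u → u * y = y * u → x * y = u * (y * x) → x * x = 1 →
      y * y ≠ 1 → HasOrderedProd (Finset.univ.filter fun x : G => u * x = x * u) 1 := by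
    intro x y hx hy hxy hxx hyy
    have hxT : x ∈ Finset.univ.filter fun x : G => u * x = x * u ∧ x * x = 1 := by simp [hx, hxx]
    have hyD : y ∈ Finset.univ.filter fun x : G => u * x = x * u ∧ x * x ≠ 1 := by simp [hy, hyy]
    have huxT := (mul_mem_involutions hu hxT).1
    have hyiD := inv_mem_centralizer_sdiff hyD
    have hdisj : ∀ a b : G, a ∈ (Finset.univ.filter fun x : G => u * x = x * u ∧ x * x = 1) →
        b ∈ (Finset.univ.filter fun x : G => u * x = x * u ∧ x * x ≠ 1) → a ≠ b :=
      fun a b ha hb => (Finset.disjoint_iff_ne.1 (disjoint_filter_centralizer u)) a ha b hb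
    -- Interleaving a `u`-pair with an inverse pair gives product 1 instead of `u`.
    have hprod : HasOrderedProd ({x, u * x} ∪ {y, y⁻¹} : Finset G) 1 := by
      have := hasOrderedProd_toFinset (l := [x, y, u * x, y⁻¹]) (by
        simp only [List.nodup_cons, List.mem_cons, List.not_mem_nil, or_false, not_or,
          not_false_eq_true, List.nodup_nil, and_true]
        exact ⟨⟨hdisj _ _ hxT hyD, by simpa using hu1, hdisj _ _ hxT hyiD.1⟩,
          ⟨(hdisj _ _ huxT hyD).symm, hyiD.2.symm⟩, hdisj _ _ huxT hyiD.1⟩)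
      have e : [x, y, u * x, y⁻¹].prod = 1 := by
        simp only [List.prod_cons, List.prod_nil, mul_one]
        calc x * (y * (u * x * y⁻¹)) = (x * y) * (u * x) * y⁻¹ := by group
          _ = u * (y * (x * (u * x))) * y⁻¹ := by rw [hxy]; group
          _ = u * (y * u) * y⁻¹ := by rw [hx, ← mul_assoc x, hxx, one_mul]
          _ = 1 := by rw [← hy, hu', mul_inv_cancel]
      rw [e] at this
      convert this using 1
      ext a
      simp only [Finset.mem_union, Finset.mem_insert, Finset.mem_singleton, List.mem_toFinset,
        List.mem_cons, List.not_mem_nil, or_false]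
      tauto
    have hsubT : ({x, u * x} : Finset G) ⊆
        Finset.univ.filter fun x : G => u * x = x * u ∧ x * x = 1 := by
      intro a ha
      rcases Finset.mem_insert.1 ha with rfl | ha
      · exact hxT
      · rw [Finset.mem_singleton.1 ha]; exact huxT
    have hsubD : ({y, y⁻¹} : Finset G) ⊆
        Finset.univ.filter fun x : G => u * x = x * u ∧ x * x ≠ 1 := by
      intro a ha
      rcases Finset.mem_insert.1 ha with rfl | ha
      · exact hyD
      · rw [Finset.mem_singleton.1 ha]; exact hyiD.1
    obtain ⟨j, hj, hq⟩ := hasOrderedProd_pow_of_mul_mem hu1 hu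
      ((Finset.univ.filter fun x : G => u * x = x * u ∧ x * x = 1) \ {x, u * x}) (by
        intro a ha
        obtain ⟨ha, hn⟩ := Finset.mem_sdiff.1 ha
        obtain ⟨h1, h2, h3⟩ := mul_mem_involutions hu ha
        refine ⟨Finset.mem_sdiff.2 ⟨h1, ?_⟩, h2, h3⟩
        simp only [Finset.mem_insert, Finset.mem_singleton, not_or] at hn ⊢
        refine ⟨fun h => hn.2 (by rw [← h, hu']), fun h => hn.1 (mul_left_cancel h)⟩)
    have hcard := Finset.card_sdiff_add_card_eq_card hsubT
    rw [Finset.card_pair (by simpa using hu1)] at hcard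
    -- Removing two elements from a set whose size is 2 modulo 4 leaves a multiple of four.
    obtain ⟨i, rfl⟩ : 2 ∣ j := by omega
    rw [pow_mul, pow_two, hu, one_pow] at hq
    have hr : HasOrderedProd
        ((Finset.univ.filter fun x : G => u * x = x * u ∧ x * x ≠ 1) \ {y, y⁻¹}) 1 := by
      refine hasOrderedProd_of_inv_mem _ (fun a ha => ?_) fun a ha =>
        (inv_mem_centralizer_sdiff (Finset.mem_sdiff.1 ha).1).2
      obtain ⟨ha, hn⟩ := Finset.mem_sdiff.1 ha
      refine Finset.mem_sdiff.2 ⟨(inv_mem_centralizer_sdiff ha).1, ?_⟩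
      simp only [Finset.mem_insert, Finset.mem_singleton, not_or, inv_inj] at hn ⊢
      exact ⟨fun h => hn.2 (by rw [← h, inv_inv]), hn.1⟩
    have hrest := hq.union hr ((disjoint_filter_centralizer u).mono Finset.sdiff_subset
      Finset.sdiff_subset)
    have := hprod.union hrest (by
      rw [Finset.disjoint_left]
      intro a ha hb
      rw [Finset.mem_union, Finset.mem_sdiff, Finset.mem_sdiff] at hb
      rcases Finset.mem_union.1 ha with ha | ha <;> rcases hb with ⟨hb, hn⟩ | ⟨hb, hn⟩
      · exact hn ha
      · exact hdisj a a (hsubT ha) hb rfl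
      · exact hdisj a a hb (hsubD ha) rfl
      · exact hn ha)
    rw [mul_one, mul_one] at this
    rw [filter_centralizer_eq_union, ← Finset.union_sdiff_of_subset hsubT,
      ← Finset.union_sdiff_of_subset hsubD, Finset.union_union_union_comm]
    exact this
  by_cases hxx : x * x = 1
  · by_cases hyy : y * y = 1
    · refine mixed x (x * y) hx ?_ ?_ hxx ?_
      · rw [← mul_assoc, hx, mul_assoc, hy, mul_assoc]
      · calc x * (x * y) = x * (u * (y * x)) := by rw [hxy]
          _ = u * (x * y * x) := by rw [← mul_assoc, ← hx]; group
      · intro h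
        apply hu1
        calc u = u * ((y * x) * (x * y)) := by
              rw [mul_assoc y, ← mul_assoc x, hxx, one_mul, hyy, mul_one]
          _ = (x * y) * (x * y) := by rw [← mul_assoc, ← hxy]
          _ = 1 := h
    · exact mixed x y hx hy hxy hxx hyy
  · by_cases hyy : y * y = 1
    · exact mixed y x hy hx (by rw [hxy, hu']) hyy hxx
    · have hxD : x ∈ Finset.univ.filter fun x : G => u * x = x * u ∧ x * x ≠ 1 := by
        simp [hx, hxx]
      have hyD : y ∈ Finset.univ.filter fun x : G => u * x = x * u ∧ x * x ≠ 1 := by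
        simp [hy, hyy]
      have hxi := inv_mem_centralizer_sdiff hxD
      have hyi := inv_mem_centralizer_sdiff hyD
      have n1 : x ≠ y := fun h => hne (by rw [h])
      have n2 : x ≠ y⁻¹ := fun h => hne (by rw [h]; simp)
      have n3 : x⁻¹ ≠ y := fun h => hne (by rw [← h]; simp)
      have hl : [x, y, x⁻¹, y⁻¹].Nodup := by
        simp only [List.nodup_cons, List.mem_cons, List.not_mem_nil, or_false, not_or,
          not_false_eq_true, List.nodup_nil, and_true]
        exact ⟨⟨n1, hxi.2.symm, n2⟩, ⟨n3.symm, hyi.2.symm⟩, fun h => n1 (inv_injective h)⟩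
      have hb := hasOrderedProd_toFinset hl
      have e : [x, y, x⁻¹, y⁻¹].prod = u := by
        simp only [List.prod_cons, List.prod_nil, mul_one]
        rw [← mul_assoc, hxy]; group
      rw [e] at hb
      have hD : HasOrderedProd (Finset.univ.filter fun x : G => u * x = x * u ∧ x * x ≠ 1)
          (u * 1) := by
        refine hb.sdiff_union (hasOrderedProd_of_inv_mem _ (fun a ha => ?_) fun a ha =>
          (inv_mem_centralizer_sdiff (Finset.mem_sdiff.1 ha).1).2) ?_
        · obtain ⟨ha, hn⟩ := Finset.mem_sdiff.1 ha
          refine Finset.mem_sdiff.2 ⟨(inv_mem_centralizer_sdiff ha).1, fun h => hn ?_⟩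
          simp only [List.mem_toFinset, List.mem_cons, List.not_mem_nil, or_false] at h ⊢
          rcases h with h | h | h | h
          · exact Or.inr (Or.inr (Or.inl (by rw [← h, inv_inv])))
          · exact Or.inr (Or.inr (Or.inr (by rw [← h, inv_inv])))
          · exact Or.inl (inv_injective h)
          · exact Or.inr (Or.inl (inv_injective h))
        · intro a ha
          simp only [List.mem_toFinset, List.mem_cons, List.not_mem_nil, or_false] at ha
          rcases ha with rfl | rfl | rfl | rfl
          exacts [hxD, hyD, hxi.1, hyi.1]
      -- The product `u` of the involution part, from odd `k`, cancels the commutator `u`.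
      obtain ⟨j, rfl⟩ : ∃ j, k = 2 * j + 1 := ⟨k / 2, by omega⟩
      rw [pow_succ, pow_mul, pow_two, hu, one_pow, one_mul] at hp
      have := hp.union hD (disjoint_filter_centralizer u)
      rw [mul_one, hu] at this
      rwa [filter_centralizer_eq_union]

/-- If `u` is not a commutator in its centralizer, which contains another involution `s`, then the
number of solutions of `x * x = 1` there is divisible by four. -/
theorem four_dvd_card_involutions {u s : G} (hu1 : u ≠ 1) (hu : u * u = 1) (hs1 : s ≠ 1)
    (hs : s * s = 1) (hsu : s ≠ u) (hus : u * s = s * u)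
    (hcomm : ∀ x y : G, u * x = x * u → u * y = y * u → x * y ≠ u * (y * x)) :
    4 ∣ (Finset.univ.filter fun x : G => u * x = x * u ∧ x * x = 1).card := by
  have hu' : ∀ x : G, u * (u * x) = x := fun x => by rw [← mul_assoc, hu, one_mul]
  have hs' : ∀ x : G, s * (s * x) = x := fun x => by rw [← mul_assoc, hs, one_mul]
  have hus' : ∀ x : G, u * (s * x) = s * (u * x) := fun x => by rw [← mul_assoc, hus, mul_assoc]
  rw [← Finset.card_filter_add_card_filter_not (fun x => s * x = x * s)]
  refine Dvd.dvd.add ?_ ?_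
  · refine four_dvd_card_of_involutive (a := fun x => u * x) (b := fun x => s * x) hu' hs' hus' _ ?_
    intro x hx
    simp only [Finset.mem_filter, Finset.mem_univ, true_and] at hx ⊢
    obtain ⟨⟨h1, h2⟩, h3⟩ := hx
    refine ⟨⟨⟨?_, ?_⟩, ?_⟩, ⟨⟨?_, ?_⟩, ?_⟩, by simpa using hu1, by simpa using hs1,
      fun h => hsu (mul_right_cancel h).symm⟩
    · rw [mul_assoc, ← h1]
    · rw [mul_assoc, ← mul_assoc x, ← h1, mul_assoc, h2, mul_one, hu]
    · rw [← hus', h3, mul_assoc]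
    · rw [hus', h1, mul_assoc]
    · rw [mul_assoc, ← mul_assoc x, ← h3, mul_assoc, h2, mul_one, hs]
    · rw [mul_assoc, ← h3]
  -- Off the centralizer of `s`, conjugation by `s` replaces translation. A coincidence `u * x = s *
  -- x * s` would make `u` a commutator of `s` and `x`.
  · refine four_dvd_card_of_involutive (a := fun x => u * x) (b := fun x => s * (x * s)) hu'
      (fun x => by simp [mul_assoc, hs', hs]) (fun x => by simp only [hus', mul_assoc]) _ ?_
    intro x hx
    simp only [Finset.mem_filter, Finset.mem_univ, true_and] at hx ⊢
    obtain ⟨⟨h1, h2⟩, h3⟩ := hx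
    have h2' : ∀ z : G, x * (x * z) = z := fun z => by rw [← mul_assoc, h2, one_mul]
    refine ⟨⟨⟨?_, ?_⟩, fun h => h3 ?_⟩, ⟨⟨?_, ?_⟩, fun h => h3 ?_⟩, by simpa using hu1,
      fun h => h3 ?_, fun h => hcomm s x hus h1 ?_⟩
    · rw [mul_assoc, ← h1]
    · rw [mul_assoc, ← mul_assoc x, ← h1, mul_assoc, h2, mul_one, hu]
    · rw [← hus', mul_assoc] at h; exact mul_left_cancel h
    · rw [hus', ← mul_assoc u, h1, mul_assoc x, hus]; simp only [mul_assoc]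
    · simp only [mul_assoc, hs', h2', hs]
    · simp only [mul_assoc, hs', hs, mul_one] at h; exact h.symm
    · nth_rw 2 [← h]; simp only [mul_assoc, hs, mul_one]
    · calc s * x = s * (x * s) * s := by simp only [mul_assoc, hs, mul_one]
        _ = u * (x * s) := by rw [← h, mul_assoc]

end Involution

/-! ### From the Sylow condition to an ordering, and the conclusion. -/

theorem SylowTwoTrivialOrNonCyclic.hasOrderedProd_univ {G : Type*} [Group G] [Fintype G]
    (h : SylowTwoTrivialOrNonCyclic G) : HasOrderedProd (Finset.univ : Finset G) 1 := by
  classical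
  obtain ⟨P⟩ : Nonempty (Sylow 2 G) := inferInstance
  rcases h P with hP | hP
  · have hodd : ¬ 2 ∣ Nat.card G := by
      have := P.not_dvd_index
      rwa [hP, Subgroup.index_bot] at this
    have hinv : ∀ x : G, x ≠ 1 → x⁻¹ ≠ x := by
      intro x hx hxx
      apply hodd
      have : orderOf x = 2 := orderOf_eq_prime (by
        rw [pow_two]; nth_rw 1 [← hxx]; exact inv_mul_cancel x) hx
      rw [← this]
      exact orderOf_dvd_natCard x
    have h1 := hasOrderedProd_toFinset (l := [(1 : G)]) (by simp)
    have := h1.sdiff_union (S := Finset.univ) (q := 1)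
      (hasOrderedProd_of_inv_mem _ (by simp) (by simpa using hinv)) (Finset.subset_univ _)
    simpa using this
  · have hnt : Nontrivial P := by
      by_contra hn
      rw [not_nontrivial_iff_subsingleton] at hn
      exact hP inferInstance
    have := P.2.center_nontrivial
    have hZ : 2 ∣ Nat.card (Subgroup.center P) :=
      (P.2.to_subgroup (Subgroup.center P)).card_eq_or_dvd.resolve_left
        Finite.one_lt_card.ne'
    obtain ⟨⟨⟨u, huP⟩, huZ⟩, hord⟩ := exists_prime_orderOf_dvd_card' 2 hZ
    have hu : u * u = 1 := by
      have h2 := pow_orderOf_eq_one (⟨⟨u, huP⟩, huZ⟩ : Subgroup.center P)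
      rw [hord, pow_two] at h2
      exact congrArg (fun z : Subgroup.center P => ((z : P) : G)) h2
    have hu1 : u ≠ 1 := by
      rintro rfl
      have h2 : (⟨⟨1, huP⟩, huZ⟩ : Subgroup.center P) = 1 := rfl
      rw [h2, orderOf_one] at hord
      omega
    have hcomm : ∀ x ∈ P, u * x = x * u := fun x hx =>
      (congrArg (fun z : P => (z : G)) (Subgroup.mem_center_iff.1 huZ ⟨x, hx⟩)).symm
    have hC : HasOrderedProd (Finset.univ.filter fun x : G => u * x = x * u) 1 := by
      by_cases h4 : 4 ∣ (Finset.univ.filter fun x : G => u * x = x * u ∧ x * x = 1).card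
      · exact hasOrderedProd_centralizer_of_four_dvd hu1 hu h4
      by_cases hex : ∃ x y : G, u * x = x * u ∧ u * y = y * u ∧ x * y = u * (y * x)
      · obtain ⟨x, y, hx, hy, hxy⟩ := hex
        exact hasOrderedProd_centralizer_of_commutator hu1 hu h4 hx hy hxy
      push Not at hex
      exfalso
      -- A second involution in `P` would contradict `h4`. Since `P` centralizes `u`, the resulting
      -- commutator contradicts `hex`.
      obtain ⟨x, y, hxy⟩ := exists_commutator_eq_of_unique_involution P.2 hP (u := ⟨u, huP⟩) (by
        intro s hs
        by_contra hn
        push Not at hn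
        refine h4 (four_dvd_card_involutions (s := s) hu1 hu (fun h => hn.1 (Subtype.ext h))
          (congrArg (fun z : P => (z : G)) hs) (fun h => hn.2 (Subtype.ext h))
          (hcomm _ s.2) hex))
      exact hex x y (hcomm _ x.2) (hcomm _ y.2) (congrArg (fun z : P => (z : G)) hxy)
    have := hC.union (hasOrderedProd_compl_centralizer hu)
      (Finset.disjoint_filter_filter_not _ _ _)
    rwa [Finset.filter_union_filter_not_eq, mul_one] at this

end LatinPlex

theorem LatinPlex.hallPaigeFor_iff {G : Type*} [Group G] [Finite G] :
    LatinPlex.HallPaigeFor G ↔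
      (LatinPlex.HasTransversal G ↔ LatinPlex.HasRegularRowTransversal G) := by
  have := Fintype.ofFinite G
  rw [hasRegularRowTransversal_iff_hasFullProductOne, HallPaigeFor]
  have h23 : SylowTwoTrivialOrNonCyclic G ↔ HasFullProductOne G :=
    ⟨fun h => hasFullProductOne_iff.2 h.hasOrderedProd_univ,
      HasFullProductOne.sylowTwoTrivialOrNonCyclic⟩
  refine ⟨fun h => h.out 0 2, fun h => ?_⟩
  tfae_have 1 ↔ 3 := h
  tfae_have 2 ↔ 3 := h23
  tfae_finish

theorem mainTheorem7 :
    (LatinPlex.HallPaigeTheorem.{u} ↔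
      ∀ (G : Type u) [Group G] [Finite G],
        LatinPlex.HasTransversal G ↔ LatinPlex.HasRegularRowTransversal G) ∧
    (∀ (G : Type u) [Group G] [Finite G],
      LatinPlex.HallPaigeFor G ↔
        (LatinPlex.HasTransversal G ↔ LatinPlex.HasRegularRowTransversal G)) := by
  refine ⟨?_, fun G _ _ => LatinPlex.hallPaigeFor_iff⟩
  exact forall_congr' fun G => forall_congr' fun _ => forall_congr' fun _ =>
    LatinPlex.hallPaigeFor_iff
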